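/- Let $[m]=\{1,\dots,m\}$. A matching of size $n$ is a partition $M$ of $[2n]$ into $2$-element sets, called edges. For $1\le k\le 2n$ let $x_k(M)$ be the number of edges of $M$ with one endpoint in $[k]$ and the other in $[2n]\setminus[k]$; the sock number of $M$ is $\max_{1\le k\le 2n}x_k(M)$ (and $0$ if $n=0$). A sub-matching (subset of the edges) of $M$ is bipartite if all left-ends of its edges precede all right-ends of its edges, and alignment-free if it does not contain two edges $e,f$ such that every element of $e$ is smaller than every element of $f$. (i) For every $n\ge 0$ and every matching $M$ of size $n$, a sub-matching of $M$ is bipartite if and only if it is alignment-free, and the sock number of $M$ equals the largest number of edges of a bipartite sub-matching of $M$. (ii) Let $Y$ be the sock number of a matching chosen uniformly at random from all $(2n)!/(2^n n!)$ matchings of size $n$. There is a constant $C>0$ such that $$\lim_{n\to\infty}\Pr\left(\left|Y-\frac n2\right|\le C\sqrt{n\log n}\right)=1 .$$ -/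

import Mathlib

open Filter Topology MeasureTheory ProbabilityTheory

/-- The (ordered) matchings of size `n`: partitions of `[2n] = {1, …, 2n}` into 2-element sets
(the edges). -/
abbrev OrderedMatching (n : ℕ) : Type :=
  {P : Finpartition (Finset.Icc 1 (2 * n)) // ∀ e ∈ P.parts, e.card = 2}

namespace OrderedMatching

/-- The set of edges of a matching. -/
def edges {n : ℕ} (M : OrderedMatching n) : Finset (Finset ℕ) := M.1.parts

/-- `x_k(M)`: the number of edges of `M` with one endpoint in `[k]` and the other
in `[2n] \ [k]`. -/
def sockuence {n : ℕ} (M : OrderedMatching n) (k : ℕ) : ℕ :=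
  (M.edges.filter fun e => (∃ i ∈ e, i ≤ k) ∧ (∃ j ∈ e, k < j)).card

/-- The sock number `max_{1 ≤ k ≤ 2n} x_k(M)` (it is `0` for `n = 0`). -/
def sockNumber {n : ℕ} (M : OrderedMatching n) : ℕ :=
  (Finset.Icc 1 (2 * n)).sup M.sockuence

/-- A set of edges is bipartite if all left-ends of its edges precede all right-ends. -/
def IsBipartite (S : Finset (Finset ℕ)) : Prop :=
  ∀ e ∈ S, ∀ f ∈ S, ∀ i j : ℕ, IsLeast (e : Set ℕ) i → IsGreatest (f : Set ℕ) j → i < j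

/-- Two edges form an alignment (pattern `AABB`) if the first one lies entirely to the left
of the second one. -/
def IsAlignment (e f : Finset ℕ) : Prop :=
  ∀ i ∈ e, ∀ j ∈ f, i < j

/-- A set of edges is alignment-free if no two different edges of it form an alignment. -/
def IsAlignmentFree (S : Finset (Finset ℕ)) : Prop :=
  ∀ e ∈ S, ∀ f ∈ S, e ≠ f → ¬ IsAlignment e f

/-- All sets of matchings of the (finite) sample space are events. -/
instance (n : ℕ) : MeasurableSpace (OrderedMatching n) := ⊤

/-- The law of the random matching of `[2n]`: the uniform distribution on all matchings. -/
noncomputable def randomMatching (n : ℕ) : Measure (OrderedMatching n) :=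
  uniformOn Set.univ

end OrderedMatching

/-! The edges crossing a cut at `k` form a bipartite sub-matching. Conversely, every edge of a
bipartite sub-matching crosses the cut at its largest left-end. So the sock number is the largest
size of a bipartite sub-matching.

For concentration, fix a cut with `r` and `b` points on its sides, `r + b = 2n`. With `r = j + 2u`
and `b = j + 2v`, exactly `r! b! / (j! u! v! 2^(u+v))` matchings have `j` split edges
(`crossingCount_mul`), so passing from `j` to `j + 2` multiplies the count by `(r - j)(b - j) / ((j
+ 1)(j + 2))`. Since `(r - j)(b - j) ≤ (n - j)²`, this ratio is at most `exp(-8s/n)` once `j ≥ n/2 +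
2s`, whatever the cut. Iterating `s` times bounds the proportion of matchings with a given `j ≥ n/2
+ 4s` by `exp(-8s²/n)` (`crossingCount_upper_tail`). For the balanced cut the lower tail is
symmetric (`crossingCount_lower_tail`), and this one cut suffices to bound a maximum from below. A
union bound over cuts and values of `j`, with `s` about `√(n log n)`, finishes the proof. -/

/-- The number of sets in `P` having both a point inside and a point outside `p`. -/
def crossingNumber {α : Type*} (p : α → Prop) [DecidablePred p] (P : Finset (Finset α)) : ℕ :=
  (P.filter fun e => (∃ i ∈ e, p i) ∧ ∃ j ∈ e, ¬ p j).card

theorem crossingNumber_not {α : Type*} (p : α → Prop) [DecidablePred p] (P : Finset (Finset α)) :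
    crossingNumber (fun x => ¬ p x) P = crossingNumber p P := by
  unfold crossingNumber
  congr 1
  ext e
  simp only [Finset.mem_filter, not_not]
  tauto

/-! ### Exact count of perfect matchings by number of split edges -/

section PerfectMatchings

variable {α : Type*} [DecidableEq α]

open Classical in
/-- The partitions of the finite set `A` into two-element sets. -/
noncomputable def perfectMatchings (A : Finset α) : Finset (Finset (Finset α)) :=
  A.powerset.powerset.filter fun P =>
    (∀ e ∈ P, e.card = 2) ∧ (P : Set (Finset α)).PairwiseDisjoint id ∧ P.sup id = A

theorem mem_perfectMatchings {A : Finset α} {P : Finset (Finset α)} :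
    P ∈ perfectMatchings A ↔
      (∀ e ∈ P, e.card = 2) ∧ (P : Set (Finset α)).PairwiseDisjoint id ∧ P.sup id = A := by
  simp only [perfectMatchings, Finset.mem_filter, Finset.mem_powerset, and_iff_right_iff_imp]
  rintro ⟨-, -, rfl⟩ e he
  exact Finset.mem_powerset.2 (Finset.le_sup (f := id) he)

theorem perfectMatchings_empty : perfectMatchings (∅ : Finset α) = {∅} := by
  ext P
  rw [mem_perfectMatchings, Finset.mem_singleton]
  constructor
  · rintro ⟨h2, -, hs⟩
    refine Finset.eq_empty_of_forall_notMem fun e he => ?_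
    have h : e ⊆ ∅ := hs ▸ Finset.le_sup (f := id) he
    have := h2 e he
    rw [Finset.subset_empty.1 h] at this
    simp at this
  · rintro rfl
    simp

theorem subset_of_mem_perfectMatchings {A : Finset α} {P : Finset (Finset α)}
    (hP : P ∈ perfectMatchings A) {e : Finset α} (he : e ∈ P) : e ⊆ A :=
  (mem_perfectMatchings.1 hP).2.2 ▸ Finset.le_sup (f := id) he

theorem notMem_of_mem_perfectMatchings_erase {A : Finset α} {a c : α} {P : Finset (Finset α)}
    (hP : P ∈ perfectMatchings ((A.erase a).erase c)) {e : Finset α} (he : a ∈ e) : e ∉ P := by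
  intro h
  have := subset_of_mem_perfectMatchings hP h he
  simp at this

theorem insert_mem_perfectMatchings {A : Finset α} {a c : α} (ha : a ∈ A) (hc : c ∈ A.erase a)
    {P : Finset (Finset α)} (hP : P ∈ perfectMatchings ((A.erase a).erase c)) :
    insert {a, c} P ∈ perfectMatchings A := by
  have hP' := mem_perfectMatchings.1 hP
  rw [Finset.mem_erase] at hc
  refine mem_perfectMatchings.2 ⟨?_, ?_, ?_⟩
  · intro e he
    rcases Finset.mem_insert.1 he with rfl | he
    · exact Finset.card_pair hc.1.symm
    · exact hP'.1 e he
  · rw [Finset.coe_insert]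
    refine hP'.2.1.insert fun e he _ => ?_
    have := subset_of_mem_perfectMatchings hP he
    rw [id, id, Finset.disjoint_left]
    intro x hx hxe
    have h3 := this hxe
    simp only [Finset.mem_insert, Finset.mem_singleton] at hx
    simp only [Finset.mem_erase] at h3
    tauto
  · rw [Finset.sup_insert, hP'.2.2]
    ext x
    simp only [id, Finset.sup_eq_union, Finset.mem_union, Finset.mem_insert,
      Finset.mem_singleton, Finset.mem_erase]
    constructor
    · rintro ((rfl | rfl) | h)
      exacts [ha, hc.2, h.2.2]
    · tauto

theorem exists_insert_of_mem_perfectMatchings {A : Finset α} {a : α} (ha : a ∈ A)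
    {P : Finset (Finset α)} (hP : P ∈ perfectMatchings A) :
    ∃ c ∈ A.erase a, ∃ Q ∈ perfectMatchings ((A.erase a).erase c), insert {a, c} Q = P := by
  obtain ⟨h2, hd, hs⟩ := mem_perfectMatchings.1 hP
  have ha' := ha
  rw [← hs, Finset.mem_sup] at ha'
  obtain ⟨e, he, hae⟩ := ha'
  rw [id] at hae
  obtain ⟨c, hc⟩ : ∃ c, e.erase a = {c} := by
    rw [← Finset.card_eq_one, Finset.card_erase_of_mem hae, h2 e he]
  have hec : e = {a, c} := by rw [← Finset.insert_erase hae, hc]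
  have hce : c ∈ e.erase a := hc ▸ Finset.mem_singleton_self c
  rw [Finset.mem_erase] at hce
  refine ⟨c, Finset.mem_erase.2 ⟨hce.1, subset_of_mem_perfectMatchings hP he hce.2⟩,
    P.erase e, mem_perfectMatchings.2 ⟨fun f hf => h2 f (Finset.mem_of_mem_erase hf),
      hd.subset (Finset.coe_subset.2 (Finset.erase_subset _ _)), ?_⟩, ?_⟩
  · ext x
    rw [Finset.mem_sup, Finset.mem_erase, Finset.mem_erase]
    constructor
    · rintro ⟨f, hf, hx⟩
      rw [Finset.mem_erase] at hf
      have hdis := hd hf.2 he hf.1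
      rw [Function.onFun, id, id, Finset.disjoint_left] at hdis
      have hxe := hdis hx
      rw [hec] at hxe
      simp only [Finset.mem_insert, Finset.mem_singleton, not_or] at hxe
      exact ⟨hxe.2, hxe.1, subset_of_mem_perfectMatchings hP hf.2 hx⟩
    · rintro ⟨hxc, hxa, hxA⟩
      rw [← hs, Finset.mem_sup] at hxA
      obtain ⟨f, hf, hx⟩ := hxA
      refine ⟨f, Finset.mem_erase.2 ⟨?_, hf⟩, hx⟩
      rintro rfl
      rw [hec] at hx
      simp [hxc, hxa] at hx
  · rw [← hec, Finset.insert_erase he]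

/-- Matchings of `A` are classified by the partner `c` of a given point `a`. -/
theorem card_filter_perfectMatchings {A : Finset α} {a : α} (ha : a ∈ A)
    (p : Finset (Finset α) → Prop) [DecidablePred p] :
    ((perfectMatchings A).filter p).card =
      ∑ c ∈ A.erase a, ((perfectMatchings ((A.erase a).erase c)).filter
        fun Q => p (insert {a, c} Q)).card := by
  rw [← Finset.card_sigma]
  symm
  refine Finset.card_bij (fun x _ => insert {a, x.1} x.2) ?_ ?_ ?_
  · rintro ⟨c, Q⟩ h
    simp only [Finset.mem_sigma, Finset.mem_filter] at h ⊢
    exact ⟨insert_mem_perfectMatchings ha h.1 h.2.1, h.2.2⟩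
  · rintro ⟨c, Q⟩ h ⟨d, R⟩ h' heq
    simp only [Finset.mem_sigma, Finset.mem_filter] at h h' heq
    have hnQ : ∀ e : Finset α, a ∈ e → e ∉ Q := fun e he =>
      notMem_of_mem_perfectMatchings_erase h.2.1 he
    have hnR : ∀ e : Finset α, a ∈ e → e ∉ R := fun e he =>
      notMem_of_mem_perfectMatchings_erase h'.2.1 he
    have h1 : ({a, c} : Finset α) ∈ insert {a, d} R := heq ▸ Finset.mem_insert_self _ _
    have h2 : ({a, c} : Finset α) = {a, d} :=
      (Finset.mem_insert.1 h1).resolve_right (hnR _ (by simp))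
    have hcd : c = d := by
      have : c ∈ ({a, d} : Finset α) := h2 ▸ (by simp)
      simp only [Finset.mem_insert, Finset.mem_singleton] at this
      exact this.resolve_left (Finset.ne_of_mem_erase h.1)
    subst hcd
    have hQR : Q = R := by
      rw [← Finset.erase_insert (hnQ {a, c} (by simp)), heq,
        Finset.erase_insert (hnR {a, c} (by simp))]
    rw [hQR]
  · intro P hP
    rw [Finset.mem_filter] at hP
    obtain ⟨c, hc, Q, hQ, rfl⟩ := exists_insert_of_mem_perfectMatchings ha hP.1
    refine ⟨⟨c, Q⟩, ?_, rfl⟩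
    simp only [Finset.mem_sigma, Finset.mem_filter]
    exact ⟨hc, hQ, hP.2⟩

theorem crossingNumber_insert_pair (p : α → Prop) [DecidablePred p] {a c : α}
    {P : Finset (Finset α)} (h : {a, c} ∉ P) :
    crossingNumber p (insert {a, c} P) =
      crossingNumber p P + if (p a ↔ p c) then 0 else 1 := by
  unfold crossingNumber
  rw [Finset.filter_insert]
  have key : ((∃ i ∈ ({a, c} : Finset α), p i) ∧ ∃ j ∈ ({a, c} : Finset α), ¬ p j) ↔
      ¬ (p a ↔ p c) := by
    simp only [Finset.mem_insert, Finset.mem_singleton, exists_eq_or_imp, exists_eq_left]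
    tauto
  by_cases hac : (p a ↔ p c)
  · rw [if_neg (by rw [key]; exact not_not.2 hac), if_pos hac, add_zero]
  · rw [if_pos (by rw [key]; exact hac), if_neg hac, Finset.card_insert_of_notMem]
    simp [h]

/-- A split edge has one point in `p`, and an unsplit edge has two or none. -/
theorem exists_card_filter_eq_crossingNumber_add (p : α → Prop) [DecidablePred p] {A : Finset α}
    {P : Finset (Finset α)} (hP : P ∈ perfectMatchings A) :
    ∃ m, (A.filter p).card = crossingNumber p P + 2 * m := by
  obtain ⟨h2, hd, hs⟩ := mem_perfectMatchings.1 hP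
  refine ⟨(P.filter fun e => ∀ i ∈ e, p i).card, ?_⟩
  have hA : A.filter p = P.biUnion fun e => e.filter p := by
    rw [← hs]
    ext x
    simp only [Finset.mem_filter, Finset.mem_sup, Finset.mem_biUnion, id]
    tauto
  rw [hA, Finset.card_biUnion, crossingNumber, Finset.card_filter, Finset.card_filter,
    Finset.mul_sum, ← Finset.sum_add_distrib]
  · refine Finset.sum_congr rfl fun e he => ?_
    obtain ⟨x, y, hxy, rfl⟩ := Finset.card_eq_two.1 (h2 e he)
    by_cases hx : p x <;> by_cases hy : p y <;>
      simp [Finset.filter_insert, Finset.filter_singleton, hx, hy, hxy]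
  · intro e he f hf hef
    exact (hd he hf hef).mono (Finset.filter_subset _ _) (Finset.filter_subset _ _)

/-- The number of perfect matchings of `A` with exactly `j` edges that are split by `p`. -/
noncomputable def crossingCount (p : α → Prop) [DecidablePred p] (A : Finset α) (j : ℕ) : ℕ :=
  ((perfectMatchings A).filter fun P => crossingNumber p P = j).card

/-- The edge at `a` is split exactly when the partner `c` lies outside `p`. The form `crossingNumber
p P + 1 = j` avoids truncated subtraction at `j = 0`. -/
theorem crossingCount_eq_sum (p : α → Prop) [DecidablePred p] {A : Finset α} {a : α}
    (ha : a ∈ A) (hpa : p a) (j : ℕ) :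
    crossingCount p A j =
      ∑ c ∈ (A.erase a).filter p, crossingCount p ((A.erase a).erase c) j +
      ∑ c ∈ (A.erase a).filter (fun x => ¬ p x),
        ((perfectMatchings ((A.erase a).erase c)).filter
          fun P => crossingNumber p P + 1 = j).card := by
  rw [crossingCount, card_filter_perfectMatchings ha,
    ← Finset.sum_filter_add_sum_filter_not (A.erase a) p]
  congr 1 <;> refine Finset.sum_congr rfl fun c hc => ?_
  all_goals
    rw [Finset.mem_filter] at hc
    try rw [crossingCount]
    congr 1
    refine Finset.filter_congr fun Q hQ => ?_
    rw [crossingNumber_insert_pair p (notMem_of_mem_perfectMatchings_erase hQ (by simp))]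
    simp [hpa, hc.2]

theorem crossingCount_eq_zero (p : α → Prop) [DecidablePred p] {A : Finset α} {j : ℕ}
    (h : ¬ ∃ m, (A.filter p).card = j + 2 * m) : crossingCount p A j = 0 := by
  rw [crossingCount, Finset.card_eq_zero, Finset.filter_eq_empty_iff]
  rintro P hP rfl
  exact h (exists_card_filter_eq_crossingNumber_add p hP)

theorem crossingCount_not (p : α → Prop) [DecidablePred p] (A : Finset α) (j : ℕ) :
    crossingCount (fun x => ¬ p x) A j = crossingCount p A j := by
  simp only [crossingCount, crossingNumber_not]

theorem crossingCount_eq_zero' (p : α → Prop) [DecidablePred p] {A : Finset α} {j : ℕ}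
    (h : ¬ ∃ m, (A.filter fun x => ¬ p x).card = j + 2 * m) : crossingCount p A j = 0 := by
  rw [← crossingCount_not]
  exact crossingCount_eq_zero _ h

open Nat in
/-- Exact enumeration of the perfect matchings with `j` split edges. -/
theorem crossingCount_mul (N : ℕ) : ∀ (p : α → Prop) [DecidablePred p] (A : Finset α)
    (j u v : ℕ), A.card = N → (A.filter p).card = j + 2 * u →
    (A.filter fun x => ¬ p x).card = j + 2 * v →
    crossingCount p A j * (j ! * u ! * v ! * 2 ^ (u + v)) = (j + 2 * u)! * (j + 2 * v)! := by
  induction N using Nat.strong_induction_on with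
  | _ N ih =>
  -- It suffices to treat sets with a point in `p`; otherwise the roles of `p` and its complement
  -- are exchanged.
  have step : ∀ (p : α → Prop) [DecidablePred p] (A : Finset α)
      (j u v : ℕ), A.card = N → (A.filter p).card = j + 2 * u →
      (A.filter fun x => ¬ p x).card = j + 2 * v → (∃ a ∈ A, p a) →
      crossingCount p A j * (j ! * u ! * v ! * 2 ^ (u + v)) =
        (j + 2 * u)! * (j + 2 * v)! := by
    rintro p _ A j u v hN hr hb ⟨a, ha, hpa⟩
    have hNpos : 0 < N := hN ▸ Finset.card_pos.2 ⟨a, ha⟩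
    have hr1 : ((A.erase a).filter p).card = j + 2 * u - 1 := by
      rw [Finset.filter_erase, Finset.card_erase_of_mem (by simp [ha, hpa]), hr]
    have hb1 : (A.erase a).filter (fun x => ¬ p x) = A.filter fun x => ¬ p x := by
      rw [Finset.filter_erase, Finset.erase_eq_of_notMem (by simp [hpa])]
    have hpos : 0 < j + 2 * u := hr ▸ Finset.card_pos.2 ⟨a, by simp [ha, hpa]⟩
    have hcard : ∀ c ∈ A.erase a, ((A.erase a).erase c).card < N := by
      intro c _
      refine lt_of_le_of_lt (Finset.card_le_card (Finset.erase_subset _ _)) ?_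
      rw [← hN]
      exact Finset.card_erase_lt_of_mem ha
    -- The factor `(r - 1) * r`, with `r = j + 2 * u`, clears the denominators left by removing two
    -- points of `p`. If `u = 0`, parity leaves no matching to count.
    have hsame : ∀ c ∈ (A.erase a).filter p,
        crossingCount p ((A.erase a).erase c) j * (j ! * u ! * v ! * 2 ^ (u + v)) *
          ((j + 2 * u - 1) * (j + 2 * u)) = (2 * u) * ((j + 2 * u)! * (j + 2 * v)!) := by
      intro c hc
      have hr2 : (((A.erase a).erase c).filter p).card = j + 2 * u - 1 - 1 := by
        rw [Finset.filter_erase, Finset.card_erase_of_mem hc, hr1]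
      have hb2 : (((A.erase a).erase c).filter fun x => ¬ p x).card = j + 2 * v := by
        rw [Finset.filter_erase, Finset.erase_eq_of_notMem, hb1, hb]
        simp [(Finset.mem_filter.1 hc).2]
      have hcpos : 0 < j + 2 * u - 1 := hr1 ▸ Finset.card_pos.2 ⟨c, hc⟩
      obtain _ | u := u
      · rw [crossingCount_eq_zero]
        · simp
        · rw [hr2]
          rintro ⟨m, hm⟩
          omega
      · have := ih _ (hcard c (Finset.mem_filter.1 hc).1) p _ j u v rfl
          (by rw [hr2]; omega) hb2
        have e1 : j + 2 * (u + 1) = j + 2 * u + 1 + 1 := by ring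
        rw [e1, Nat.factorial_succ (j + 2 * u + 1), Nat.factorial_succ (j + 2 * u),
          Nat.factorial_succ u, Nat.add_sub_cancel]
        calc _ = (crossingCount p ((A.erase a).erase c) j * (j ! * u ! * v ! * 2 ^ (u + v))) *
              (2 * (u + 1) * (j + 2 * u + 1) * (j + 2 * u + 1 + 1)) := by ring
          _ = _ := by rw [this]; ring
    have hdiff : ∀ c ∈ (A.erase a).filter (fun x => ¬ p x),
        ((perfectMatchings ((A.erase a).erase c)).filter
          fun P => crossingNumber p P + 1 = j).card * (j ! * u ! * v ! * 2 ^ (u + v)) *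
          ((j + 2 * v) * (j + 2 * u)) = j * ((j + 2 * u)! * (j + 2 * v)!) := by
      intro c hc
      have hr2 : (((A.erase a).erase c).filter p).card = j + 2 * u - 1 := by
        rw [Finset.filter_erase, Finset.erase_eq_of_notMem, hr1]
        simp [(Finset.mem_filter.1 hc).2]
      have hb2 : (((A.erase a).erase c).filter fun x => ¬ p x).card = j + 2 * v - 1 := by
        rw [Finset.filter_erase, Finset.card_erase_of_mem hc, hb1, hb]
      obtain _ | j := j
      · simp
      · have := ih _ (hcard c (Finset.mem_filter.1 hc).1) p _ j u v rfl
          (by rw [hr2]; omega) (by rw [hb2]; omega)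
        have e1 : ∀ w, j + 1 + 2 * w = j + 2 * w + 1 := fun w => by ring
        simp only [Nat.add_right_cancel_iff]
        rw [← crossingCount, e1, e1, Nat.factorial_succ (j + 2 * u),
          Nat.factorial_succ (j + 2 * v), Nat.factorial_succ j]
        calc _ = (crossingCount p ((A.erase a).erase c) j * (j ! * u ! * v ! * 2 ^ (u + v))) *
              ((j + 1) * (j + 2 * u + 1) * (j + 2 * v + 1)) := by ring
          _ = _ := by rw [this]; ring
    have hS1 : (∑ c ∈ (A.erase a).filter p, crossingCount p ((A.erase a).erase c) j) *
        (j ! * u ! * v ! * 2 ^ (u + v)) * (j + 2 * u) =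
        (2 * u) * ((j + 2 * u)! * (j + 2 * v)!) := by
      rcases Nat.eq_zero_or_pos (j + 2 * u - 1) with h0 | h0
      · have : (A.erase a).filter p = ∅ := by rw [← Finset.card_eq_zero, hr1, h0]
        have hu : u = 0 := by omega
        rw [this, hu]
        simp
      · refine Nat.eq_of_mul_eq_mul_left h0 ?_
        have := Finset.sum_congr rfl hsame
        rw [Finset.sum_const, hr1, smul_eq_mul, ← Finset.sum_mul, ← Finset.sum_mul] at this
        rw [← this]
        ring
    have hS2 : (∑ c ∈ (A.erase a).filter (fun x => ¬ p x),
        ((perfectMatchings ((A.erase a).erase c)).filter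
          fun P => crossingNumber p P + 1 = j).card) *
        (j ! * u ! * v ! * 2 ^ (u + v)) * (j + 2 * u) =
        j * ((j + 2 * u)! * (j + 2 * v)!) := by
      rcases Nat.eq_zero_or_pos (j + 2 * v) with h0 | h0
      · have : (A.erase a).filter (fun x => ¬ p x) = ∅ := by
          rw [← Finset.card_eq_zero, hb1, hb, h0]
        have hj : j = 0 := by omega
        rw [this, hj]
        simp
      · refine Nat.eq_of_mul_eq_mul_left h0 ?_
        have := Finset.sum_congr rfl hdiff
        rw [Finset.sum_const, hb1, hb, smul_eq_mul, ← Finset.sum_mul, ← Finset.sum_mul] at this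
        rw [hb1, ← this]
        ring
    -- After multiplication by `j + 2 * u`, the two sums contribute the shares `2 * u` and `j`,
    -- which add up to that factor.
    refine Nat.eq_of_mul_eq_mul_right hpos ?_
    rw [crossingCount_eq_sum p ha hpa, add_mul, add_mul, hS1, hS2]
    ring
  intro p _ A j u v hN hr hb
  by_cases h1 : ∃ a ∈ A, p a
  · exact step p A j u v hN hr hb h1
  by_cases h2 : ∃ a ∈ A, ¬ p a
  · have := step (fun x => ¬ p x) A j v u hN hb (by simpa using hr) h2
    rw [crossingCount_not] at this
    rw [mul_comm (j + 2 * u)!, ← this, add_comm u v]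
    ring
  · have hA : A = ∅ := by
      refine Finset.eq_empty_of_forall_notMem fun x hx => ?_
      by_cases hp : p x
      exacts [h1 ⟨x, hx, hp⟩, h2 ⟨x, hx, hp⟩]
    subst hA
    simp only [Finset.filter_empty, Finset.card_empty] at hr hb
    obtain ⟨rfl, rfl, rfl⟩ : j = 0 ∧ u = 0 ∧ v = 0 := by omega
    simp [crossingCount, perfectMatchings_empty, Finset.filter_singleton, crossingNumber]

theorem crossingCount_pos (p : α → Prop) [DecidablePred p] {A : Finset α} {j u v : ℕ}
    (hu : (A.filter p).card = j + 2 * u) (hv : (A.filter fun x => ¬ p x).card = j + 2 * v) :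
    0 < crossingCount p A j := by
  have h := crossingCount_mul _ p A j u v rfl hu hv
  refine Nat.pos_of_ne_zero fun h0 => ?_
  rw [h0, zero_mul] at h
  exact (Nat.mul_pos (Nat.factorial_pos _) (Nat.factorial_pos _)).ne h

/-- The ratio of consecutive crossing counts. -/
theorem crossingCount_add_two (p : α → Prop) [DecidablePred p] (A : Finset α) (j : ℕ) :
    ((j : ℝ) + 1) * (j + 2) * crossingCount p A (j + 2) =
      ((A.filter p).card - j) * ((A.filter fun x => ¬ p x).card - j) * crossingCount p A j := by
  by_cases hu : ∃ u, (A.filter p).card = j + 2 * u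
  swap
  · rw [crossingCount_eq_zero p hu, crossingCount_eq_zero p]
    · simp
    · rintro ⟨u, h⟩
      exact hu ⟨u + 1, by omega⟩
  by_cases hv : ∃ v, (A.filter fun x => ¬ p x).card = j + 2 * v
  swap
  · rw [crossingCount_eq_zero' p hv, crossingCount_eq_zero' p]
    · simp
    · rintro ⟨u, h⟩
      exact hv ⟨u + 1, by omega⟩
  obtain ⟨u, hu⟩ := hu
  obtain ⟨v, hv⟩ := hv
  -- For `u = 0` the factor `r - j` vanishes, and `j + 2` split edges would need more than `r`
  -- points; likewise for `v`.
  obtain _ | u := u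
  · rw [crossingCount_eq_zero p (j := j + 2), hu]
    · simp
    · rintro ⟨m, hm⟩
      omega
  obtain _ | v := v
  · rw [crossingCount_eq_zero' p (j := j + 2), hv]
    · simp
    · rintro ⟨m, hm⟩
      omega
  have h1 := crossingCount_mul _ p A j (u + 1) (v + 1) rfl hu hv
  have h2 := crossingCount_mul _ p A (j + 2) u v rfl (by omega) (by omega)
  rw [show j + 2 + 2 * u = j + 2 * (u + 1) by ring, show j + 2 + 2 * v = j + 2 * (v + 1) by ring,
    ← h1] at h2
  rw [hu, hv]
  have h3 : (j + 1) * (j + 2) * crossingCount p A (j + 2) =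
      (2 * (u + 1)) * (2 * (v + 1)) * crossingCount p A j := by
    have hpos : 0 < j.factorial * u.factorial * v.factorial * 2 ^ (u + v) := by positivity
    refine Nat.eq_of_mul_eq_mul_right hpos ?_
    simp only [Nat.factorial_succ] at h2
    calc _ = _ := by ring
      _ = _ := h2
      _ = _ := by ring
  have h4 : (((j + 1) * (j + 2) * crossingCount p A (j + 2) : ℕ) : ℝ) =
    ((2 * (u + 1)) * (2 * (v + 1)) * crossingCount p A j : ℕ) := by rw [h3]
  push_cast at h4 ⊢
  rw [h4]
  ring

end PerfectMatchings

/-! ### Exponential tail bounds for a single cut -/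

section Tails

variable {α : Type*} [DecidableEq α] (p : α → Prop) [DecidablePred p] {A : Finset α}

theorem crossingCount_le (A : Finset α) (j : ℕ) :
    crossingCount p A j ≤ (perfectMatchings A).card :=
  Finset.card_filter_le _ _

theorem crossingCount_eq_zero_of_lt {n j : ℕ} (hA : A.card = 2 * n) (hj : n < j) :
    crossingCount p A j = 0 := by
  by_contra h
  have hu : ∃ u, (A.filter p).card = j + 2 * u := by
    by_contra h'
    exact h (crossingCount_eq_zero p h')
  have hv : ∃ v, (A.filter fun x => ¬ p x).card = j + 2 * v := by
    by_contra h'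
    exact h (crossingCount_eq_zero' p h')
  obtain ⟨u, hu⟩ := hu
  obtain ⟨v, hv⟩ := hv
  have := Finset.card_filter_add_card_filter_not (s := A) p
  omega

/-- By AM-GM, `(r - i)(b - i) ≤ (n - i)²`, and `n - i ≤ (n/2)(1 - 4s/n) ≤ (n/2) exp(-4s/n)`;
squaring gives the rate `8s/n`. -/
theorem crossingCount_add_two_le {n s i : ℕ} (hn : 0 < n) (hA : A.card = 2 * n)
    (hi : n + 4 * s ≤ 2 * i) :
    (crossingCount p A (i + 2) : ℝ) ≤ Real.exp (-(8 * s / n)) * crossingCount p A i := by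
  have hn' : (0 : ℝ) < n := Nat.cast_pos.2 hn
  -- Beyond `n` the count vanishes; otherwise `n - i ≥ 0`, which the squaring below requires.
  rcases lt_or_ge n (i + 2) with h | h
  · rw [crossingCount_eq_zero_of_lt p hA h, Nat.cast_zero]
    positivity
  have hsum := Finset.card_filter_add_card_filter_not (s := A) p
  rw [hA] at hsum
  have key := crossingCount_add_two p A i
  set r : ℝ := ((A.filter p).card : ℝ) with hr
  set b : ℝ := ((A.filter fun x => ¬ p x).card : ℝ) with hb
  have hrb : r + b = 2 * n := by
    rw [hr, hb]
    exact_mod_cast hsum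
  have hi' : (n : ℝ) + 4 * s ≤ 2 * i := by exact_mod_cast hi
  have hin : (i : ℝ) + 2 ≤ n := by exact_mod_cast h
  have h1 : (r - i) * (b - i) ≤ ((n : ℝ) - i) ^ 2 := by
    have : b = 2 * n - r := by linarith
    rw [this]
    nlinarith [sq_nonneg (r - n)]
  have hexp : 1 - 4 * (s : ℝ) / n ≤ Real.exp (-(4 * s / n)) := by
    have := Real.add_one_le_exp (-(4 * (s : ℝ) / n))
    linarith
  have h2 : (n : ℝ) - i ≤ (i + 1) * Real.exp (-(4 * s / n)) := by
    calc (n : ℝ) - i ≤ n / 2 - 2 * s := by linarith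
      _ = n / 2 * (1 - 4 * s / n) := by field_simp; ring
      _ ≤ n / 2 * Real.exp (-(4 * s / n)) := by gcongr
      _ ≤ (i + 1) * Real.exp (-(4 * s / n)) := by
        gcongr
        have : (0 : ℝ) ≤ s := Nat.cast_nonneg s
        linarith
  have h3 : ((n : ℝ) - i) ^ 2 ≤ (i + 1) * (i + 2) * Real.exp (-(8 * s / n)) := by
    have e : Real.exp (-(8 * s / n)) = Real.exp (-(4 * s / n)) ^ 2 := by
      rw [← Real.exp_nat_mul]
      congr 1
      push_cast
      ring
    calc ((n : ℝ) - i) ^ 2 ≤ ((i + 1) * Real.exp (-(4 * s / n))) ^ 2 := by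
          gcongr
          linarith
      _ = (i + 1) * (i + 1) * Real.exp (-(8 * s / n)) := by rw [e]; ring
      _ ≤ _ := by gcongr; norm_num
  have hpos : (0 : ℝ) < (i + 1) * (i + 2) := by positivity
  refine le_of_mul_le_mul_left ?_ hpos
  rw [key]
  calc (r - i) * (b - i) * crossingCount p A i
      ≤ (i + 1) * (i + 2) * Real.exp (-(8 * s / n)) * crossingCount p A i := by
        exact mul_le_mul_of_nonneg_right (h1.trans h3) (Nat.cast_nonneg _)
    _ = _ := by ring

/-- The cut must be balanced here: the numerator of the ratio is then exactly `(n - i)²`, whereas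
AM-GM would bound it in the wrong direction. -/
theorem crossingCount_le_add_two {n s i : ℕ} (hn : 0 < n)
    (hr : (A.filter p).card = n) (hb : (A.filter fun x => ¬ p x).card = n)
    (hi : 2 * i + 4 + 4 * s ≤ n) :
    (crossingCount p A i : ℝ) ≤ Real.exp (-(8 * s / n)) * crossingCount p A (i + 2) := by
  have hn' : (0 : ℝ) < n := Nat.cast_pos.2 hn
  have key := crossingCount_add_two p A i
  rw [hr, hb] at key
  have hi' : 2 * (i : ℝ) + 4 + 4 * s ≤ n := by exact_mod_cast hi
  have hs : (0 : ℝ) ≤ s := Nat.cast_nonneg s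
  have hi0 : (0 : ℝ) ≤ i := Nat.cast_nonneg i
  have hexp : 1 - 4 * (s : ℝ) / n ≤ Real.exp (-(4 * s / n)) := by
    have := Real.add_one_le_exp (-(4 * (s : ℝ) / n))
    linarith
  have h2 : (i : ℝ) + 2 ≤ (n - i) * Real.exp (-(4 * s / n)) := by
    calc (i : ℝ) + 2 ≤ n / 2 - 2 * s := by linarith
      _ = n / 2 * (1 - 4 * s / n) := by field_simp; ring
      _ ≤ n / 2 * Real.exp (-(4 * s / n)) := by gcongr
      _ ≤ (n - i) * Real.exp (-(4 * s / n)) := by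
        gcongr
        linarith
  have h3 : ((i : ℝ) + 1) * (i + 2) ≤ (n - i) * (n - i) * Real.exp (-(8 * s / n)) := by
    have e : Real.exp (-(8 * s / n)) = Real.exp (-(4 * s / n)) ^ 2 := by
      rw [← Real.exp_nat_mul]
      congr 1
      push_cast
      ring
    calc ((i : ℝ) + 1) * (i + 2) ≤ (i + 2) * (i + 2) := by gcongr; norm_num
      _ ≤ ((n - i) * Real.exp (-(4 * s / n))) * ((n - i) * Real.exp (-(4 * s / n))) := by
          have h0 : (0 : ℝ) ≤ i + 2 := by positivity
          exact mul_le_mul h2 h2 h0 (h0.trans h2)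
      _ = _ := by rw [e]; ring
  have hpos : (0 : ℝ) < (n - i) * (n - i) := by
    have : (0 : ℝ) < n - i := by linarith
    positivity
  refine le_of_mul_le_mul_left ?_ hpos
  rw [← key]
  calc ((i : ℝ) + 1) * (i + 2) * crossingCount p A (i + 2)
      ≤ (n - i) * (n - i) * Real.exp (-(8 * s / n)) * crossingCount p A (i + 2) := by gcongr
    _ = _ := by ring

theorem exp_neg_pow_eq (n s : ℕ) :
    Real.exp (-(8 * s / n)) ^ s = Real.exp (-(8 * s ^ 2 / n)) := by
  rw [← Real.exp_nat_mul]
  congr 1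
  ring

/-- Half of the excess `4s` over `n/2` is spent on `s` steps of length two; the other half keeps
every step in the range of fast decay. -/
theorem crossingCount_upper_tail {n s j : ℕ} (hn : 0 < n) (hA : A.card = 2 * n)
    (hj : n + 8 * s ≤ 2 * j) :
    (crossingCount p A j : ℝ) ≤
      Real.exp (-(8 * s ^ 2 / n)) * (perfectMatchings A).card := by
  obtain ⟨i, rfl⟩ : ∃ i, j = i + 2 * s := ⟨j - 2 * s, by omega⟩
  have h : ∀ t : ℕ, (crossingCount p A (i + 2 * t) : ℝ) ≤
      Real.exp (-(8 * s / n)) ^ t * crossingCount p A i := by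
    intro t
    induction t with
    | zero => simp
    | succ t ih =>
      rw [pow_succ', mul_assoc]
      refine (crossingCount_add_two_le p (i := i + 2 * t) (s := s) hn hA (by omega)).trans ?_
      gcongr
  refine (h s).trans ?_
  rw [exp_neg_pow_eq]
  gcongr
  exact crossingCount_le p A i

theorem crossingCount_lower_tail {n s j : ℕ} (hn : 0 < n)
    (hr : (A.filter p).card = n) (hb : (A.filter fun x => ¬ p x).card = n)
    (hj : 2 * j + 8 * s ≤ n) :
    (crossingCount p A j : ℝ) ≤
      Real.exp (-(8 * s ^ 2 / n)) * (perfectMatchings A).card := by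
  have h : ∀ t : ℕ, t ≤ s → (crossingCount p A j : ℝ) ≤
      Real.exp (-(8 * s / n)) ^ t * crossingCount p A (j + 2 * t) := by
    intro t
    induction t with
    | zero => simp
    | succ t ih =>
      intro ht
      rw [pow_succ, mul_assoc]
      refine (ih (by omega)).trans ?_
      gcongr
      exact crossingCount_le_add_two p (i := j + 2 * t) hn hr hb (by omega)
  refine (h s le_rfl).trans ?_
  rw [exp_neg_pow_eq]
  gcongr
  exact crossingCount_le p A _

theorem crossingNumber_le {n : ℕ} (hA : A.card = 2 * n) {P : Finset (Finset α)}
    (hP : P ∈ perfectMatchings A) : crossingNumber p P ≤ n := by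
  by_contra h
  have := crossingCount_eq_zero_of_lt p hA (not_le.1 h)
  rw [crossingCount, Finset.card_eq_zero, Finset.filter_eq_empty_iff] at this
  exact this hP rfl

theorem card_filter_crossingNumber_le {n : ℕ} (hA : A.card = 2 * n) (q : ℕ → Prop)
    [DecidablePred q] {B : ℝ} (hB : 0 ≤ B) (h : ∀ j, q j → (crossingCount p A j : ℝ) ≤ B) :
    (((perfectMatchings A).filter fun P => q (crossingNumber p P)).card : ℝ) ≤ (n + 1) * B := by
  have hsub : ((perfectMatchings A).filter fun P => q (crossingNumber p P)) ⊆
      ((Finset.range (n + 1)).filter q).biUnion fun j =>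
        (perfectMatchings A).filter fun P => crossingNumber p P = j := by
    intro P hP
    rw [Finset.mem_filter] at hP
    simp only [Finset.mem_biUnion, Finset.mem_filter, Finset.mem_range]
    exact ⟨_, ⟨Nat.lt_succ_of_le (crossingNumber_le p hA hP.1), hP.2⟩, hP.1, rfl⟩
  have h1 : ((perfectMatchings A).filter fun P => q (crossingNumber p P)).card ≤
      ∑ j ∈ (Finset.range (n + 1)).filter q, crossingCount p A j :=
    (Finset.card_le_card hsub).trans Finset.card_biUnion_le
  calc (((perfectMatchings A).filter fun P => q (crossingNumber p P)).card : ℝ)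
      ≤ ∑ j ∈ (Finset.range (n + 1)).filter q, (crossingCount p A j : ℝ) := by exact_mod_cast h1
    _ ≤ ((Finset.range (n + 1)).filter q).card • B :=
        Finset.sum_le_card_nsmul _ _ _ fun j hj => h j (Finset.mem_filter.1 hj).2
    _ ≤ (n + 1) * B := by
        rw [nsmul_eq_mul]
        gcongr
        have := Finset.card_filter_le (Finset.range (n + 1)) q
        rw [Finset.card_range] at this
        exact_mod_cast this

end Tails

/-! ### Transfer to matchings of `[2n]` -/

namespace OrderedMatching

variable {n : ℕ}

theorem edges_mem_perfectMatchings (M : OrderedMatching n) :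
    M.edges ∈ perfectMatchings (Finset.Icc 1 (2 * n)) :=
  mem_perfectMatchings.2
    ⟨M.2, Finset.supIndep_iff_pairwiseDisjoint.1 M.1.supIndep, M.1.sup_parts⟩

theorem edges_injective : Function.Injective (edges (n := n)) :=
  fun _ _ h => Subtype.ext (Finpartition.ext h)

theorem exists_edges_eq {P : Finset (Finset ℕ)}
    (hP : P ∈ perfectMatchings (Finset.Icc 1 (2 * n))) : ∃ M : OrderedMatching n, M.edges = P := by
  obtain ⟨h2, hd, hs⟩ := mem_perfectMatchings.1 hP
  refine ⟨⟨⟨P, Finset.supIndep_iff_pairwiseDisjoint.2 hd, hs, fun h => ?_⟩, h2⟩, rfl⟩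
  have := h2 _ h
  simp at this

theorem sockuence_eq (M : OrderedMatching n) (k : ℕ) :
    M.sockuence k = crossingNumber (· ≤ k) M.edges := by
  simp only [sockuence, crossingNumber, not_le]

/-! ### Bipartite and alignment-free sub-matchings -/

theorem exists_isLeast_isGreatest (M : OrderedMatching n) {e : Finset ℕ} (he : e ∈ M.edges) :
    ∃ i j, i < j ∧ e = {i, j} ∧ IsLeast (e : Set ℕ) i ∧ IsGreatest (e : Set ℕ) j := by
  obtain ⟨x, y, hxy, rfl⟩ := Finset.card_eq_two.1 (M.2 e he)
  rcases lt_or_gt_of_ne hxy with h | h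
  · refine ⟨x, y, h, rfl, ⟨by simp, ?_⟩, ⟨by simp, ?_⟩⟩ <;>
      · intro z hz
        simp at hz
        omega
  · refine ⟨y, x, h, Finset.pair_comm _ _, ⟨by simp, ?_⟩, ⟨by simp, ?_⟩⟩ <;>
      · intro z hz
        simp at hz
        omega

theorem eq_of_mem_edges (M : OrderedMatching n) {e f : Finset ℕ} (he : e ∈ M.edges)
    (hf : f ∈ M.edges) {x : ℕ} (hxe : x ∈ e) (hxf : x ∈ f) : e = f := by
  by_contra h
  have hd := (mem_perfectMatchings.1 M.edges_mem_perfectMatchings).2.1 he hf h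
  exact Finset.disjoint_left.1 hd hxe hxf

/-- If the right-end of `f` is at most the left-end of `e`, then `f` lies weakly left of `e`, and
strictly so because distinct edges are disjoint. -/
theorem isBipartite_iff_isAlignmentFree (M : OrderedMatching n) {S : Finset (Finset ℕ)}
    (hS : S ⊆ M.edges) : IsBipartite S ↔ IsAlignmentFree S := by
  constructor
  · intro h e he f hf _ hal
    obtain ⟨-, j, -, -, -, hj⟩ := M.exists_isLeast_isGreatest (hS he)
    obtain ⟨i, -, -, -, hi, -⟩ := M.exists_isLeast_isGreatest (hS hf)
    exact lt_asymm (h f hf e he i j hi hj) (hal j hj.1 i hi.1)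
  · intro h e he f hf i j hi hj
    obtain ⟨i', j', hij, -, hi', hj'⟩ := M.exists_isLeast_isGreatest (hS he)
    by_contra hlt
    rw [not_lt] at hlt
    by_cases hef : e = f
    · subst hef
      rw [hi.unique hi', hj.unique hj'] at hlt
      omega
    · refine h f hf e he (Ne.symm hef) fun x hx y hy => ?_
      have hxy : x ≤ y := (hj.2 hx).trans (hlt.trans (hi.2 hy))
      refine lt_of_le_of_ne hxy ?_
      rintro rfl
      exact hef (M.eq_of_mem_edges (hS he) (hS hf) hy hx)

theorem isBipartite_filter (M : OrderedMatching n) (k : ℕ) :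
    IsBipartite (M.edges.filter fun e => (∃ i ∈ e, i ≤ k) ∧ ∃ j ∈ e, k < j) := by
  intro e he f hf i j hi hj
  obtain ⟨-, ⟨x, hx, hxk⟩, -⟩ := Finset.mem_filter.1 he
  obtain ⟨-, -, ⟨y, hy, hyk⟩⟩ := Finset.mem_filter.1 hf
  have := hi.2 hx
  have := hj.2 hy
  omega

theorem card_le_sockNumber (M : OrderedMatching n) {S : Finset (Finset ℕ)}
    (hS : S ⊆ M.edges) (hb : IsBipartite S) : S.card ≤ M.sockNumber := by
  rcases S.eq_empty_or_nonempty with rfl | hne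
  · simp
  choose! l hl using fun e (he : e ∈ S) => M.exists_isLeast_isGreatest (hS he)
  -- Cutting at the largest left-end puts all left-ends in `[k]` and, by bipartiteness, all
  -- right-ends beyond `k`.
  obtain ⟨e₀, he₀, hmax⟩ := S.exists_max_image l hne
  have hk : l e₀ ∈ Finset.Icc 1 (2 * n) := by
    obtain ⟨j, -, -, hi, -⟩ := hl e₀ he₀
    exact subset_of_mem_perfectMatchings M.edges_mem_perfectMatchings (hS he₀) hi.1
  refine le_trans ?_ (Finset.le_sup hk)
  refine Finset.card_le_card fun e he => Finset.mem_filter.2 ⟨hS he, ?_⟩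
  obtain ⟨j, -, -, hi, hj⟩ := hl e he
  obtain ⟨-, -, -, hi₀, -⟩ := hl e₀ he₀
  exact ⟨⟨l e, hi.1, hmax e he⟩, ⟨j, hj.1, hb e₀ he₀ e he _ _ hi₀ hj⟩⟩

theorem exists_isBipartite_card_eq (M : OrderedMatching n) :
    ∃ S ⊆ M.edges, IsBipartite S ∧ S.card = M.sockNumber := by
  rcases Nat.eq_zero_or_pos n with rfl | hn
  · exact ⟨∅, by simp, by simp [IsBipartite], by simp [sockNumber]⟩
  · obtain ⟨k, -, hk⟩ := Finset.exists_mem_eq_sup (Finset.Icc 1 (2 * n))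
      (Finset.nonempty_Icc.2 (by omega)) M.sockuence
    exact ⟨_, Finset.filter_subset _ _, M.isBipartite_filter k, hk.symm⟩

/-! ### Concentration of the sock number -/

/-- The matchings whose sock number may be far from `n / 2`. -/
def IsAtypical (n s : ℕ) (P : Finset (Finset ℕ)) : Prop :=
  (∃ k ∈ Finset.Icc 1 (2 * n), n + 8 * s ≤ 2 * crossingNumber (· ≤ k) P) ∨
    2 * crossingNumber (· ≤ n) P + 8 * s ≤ n

-- The factor `2n + 1` counts `2n` upper-tail events and one lower-tail event; `n + 1` counts the
-- possible numbers of split edges.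
open Classical in
theorem card_filter_isAtypical_le (hn : 0 < n) (s : ℕ) :
    (((perfectMatchings (Finset.Icc 1 (2 * n))).filter (IsAtypical n s)).card : ℝ) ≤
      (2 * n + 1) * ((n + 1) * (Real.exp (-(8 * s ^ 2 / n)) *
        (perfectMatchings (Finset.Icc 1 (2 * n))).card)) := by
  set A := Finset.Icc 1 (2 * n) with hA
  set B : ℝ := Real.exp (-(8 * s ^ 2 / n)) * (perfectMatchings A).card with hB
  have hB0 : 0 ≤ B := by positivity
  have hcard : A.card = 2 * n := by simp [hA]
  have hup : ∀ k : ℕ, (((perfectMatchings A).filter fun P =>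
      n + 8 * s ≤ 2 * crossingNumber (· ≤ k) P).card : ℝ) ≤ (n + 1) * B := fun k =>
    card_filter_crossingNumber_le (· ≤ k) hcard (fun j => n + 8 * s ≤ 2 * j) hB0
      fun j hj => crossingCount_upper_tail _ hn hcard hj
  have hr : (A.filter (· ≤ n)).card = n := by
    have : A.filter (· ≤ n) = Finset.Icc 1 n := by
      ext x
      simp only [hA, Finset.mem_filter, Finset.mem_Icc]
      omega
    rw [this, Nat.card_Icc, Nat.add_sub_cancel]
  have hb : (A.filter fun x => ¬ x ≤ n).card = n := by
    have := Finset.card_filter_add_card_filter_not (s := A) (· ≤ n)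
    omega
  have hlow : (((perfectMatchings A).filter fun P =>
      2 * crossingNumber (· ≤ n) P + 8 * s ≤ n).card : ℝ) ≤ (n + 1) * B :=
    card_filter_crossingNumber_le (· ≤ n) hcard (fun j => 2 * j + 8 * s ≤ n) hB0
      fun j hj => crossingCount_lower_tail _ hn hr hb hj
  have hsub : (perfectMatchings A).filter (IsAtypical n s) ⊆
      (A.biUnion fun k => (perfectMatchings A).filter fun P =>
        n + 8 * s ≤ 2 * crossingNumber (· ≤ k) P) ∪
      (perfectMatchings A).filter fun P => 2 * crossingNumber (· ≤ n) P + 8 * s ≤ n := by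
    intro P hP
    rw [Finset.mem_filter] at hP
    simp only [Finset.mem_union, Finset.mem_biUnion, Finset.mem_filter]
    rcases hP.2 with ⟨k, hk, h⟩ | h
    exacts [Or.inl ⟨k, hk, hP.1, h⟩, Or.inr ⟨hP.1, h⟩]
  have h1 := (Finset.card_le_card hsub).trans ((Finset.card_union_le _ _).trans
    (Nat.add_le_add_right Finset.card_biUnion_le _))
  calc (((perfectMatchings A).filter (IsAtypical n s)).card : ℝ)
      ≤ (∑ k ∈ A, (((perfectMatchings A).filter fun P =>
          n + 8 * s ≤ 2 * crossingNumber (· ≤ k) P).card : ℝ)) +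
        ((perfectMatchings A).filter fun P =>
          2 * crossingNumber (· ≤ n) P + 8 * s ≤ n).card := by exact_mod_cast h1
    _ ≤ A.card • ((n + 1) * B) + (n + 1) * B :=
        add_le_add (Finset.sum_le_card_nsmul _ _ _ fun k _ => hup k) hlow
    _ = (2 * n + 1) * ((n + 1) * B) := by
        rw [hcard, nsmul_eq_mul]
        push_cast
        ring

theorem abs_sockNumber_sub_le (hn : 0 < n) {s : ℕ} (M : OrderedMatching n)
    (h : ¬ IsAtypical n s M.edges) : |(M.sockNumber : ℝ) - n / 2| ≤ 4 * s := by
  simp only [IsAtypical, not_or, not_exists, not_and, not_le, ← sockuence_eq] at h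
  obtain ⟨k, hk, hsup⟩ := Finset.exists_mem_eq_sup (Finset.Icc 1 (2 * n))
    (Finset.nonempty_Icc.2 (by omega)) M.sockuence
  have h1 : 2 * M.sockNumber < n + 8 * s := by
    rw [sockNumber, hsup]
    exact h.1 k hk
  have h2 : n < 2 * M.sockNumber + 8 * s := by
    have : M.sockuence n ≤ M.sockNumber := Finset.le_sup (Finset.mem_Icc.2 ⟨hn, by omega⟩)
    omega
  have h1' : 2 * (M.sockNumber : ℝ) < n + 8 * s := by exact_mod_cast h1
  have h2' : (n : ℝ) < 2 * M.sockNumber + 8 * s := by exact_mod_cast h2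
  rw [abs_le]
  constructor <;> linarith

/-- Existence is read off the exact count for the trivial cut, where no edge is split. -/
theorem card_perfectMatchings_pos (n : ℕ) :
    0 < (perfectMatchings (Finset.Icc 1 (2 * n))).card :=
  (crossingCount_pos (fun _ => True) (A := Finset.Icc 1 (2 * n)) (j := 0) (u := n) (v := 0)
    (by simp) (by simp)).trans_le (crossingCount_le _ _ 0)

instance : Finite (OrderedMatching n) :=
  Finite.of_injective (fun M : OrderedMatching n =>
    (⟨M.edges, M.edges_mem_perfectMatchings⟩ : perfectMatchings (Finset.Icc 1 (2 * n))))
    fun _ _ h => edges_injective (Subtype.ext_iff.1 h)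

instance : Nonempty (OrderedMatching n) := by
  obtain ⟨P, hP⟩ := Finset.card_pos.1 (card_perfectMatchings_pos n)
  exact ⟨(exists_edges_eq hP).choose⟩

instance : IsProbabilityMeasure (randomMatching n) :=
  isProbabilityMeasure_uniformOn' Set.finite_univ Set.univ_nonempty MeasurableSet.univ

theorem card_filter_edges [Fintype (OrderedMatching n)] (q : Finset (Finset ℕ) → Prop)
    [DecidablePred q] :
    (Finset.univ.filter fun M : OrderedMatching n => q M.edges).card =
      ((perfectMatchings (Finset.Icc 1 (2 * n))).filter q).card := by
  refine Finset.card_bij (fun M _ => M.edges) ?_ (fun _ _ _ _ h => edges_injective h) ?_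
  · intro M hM
    exact Finset.mem_filter.2 ⟨M.edges_mem_perfectMatchings, (Finset.mem_filter.1 hM).2⟩
  · intro P hP
    rw [Finset.mem_filter] at hP
    obtain ⟨M, rfl⟩ := exists_edges_eq hP.1
    exact ⟨M, by simp [hP.2], rfl⟩

theorem randomMatching_setOf_edges (q : Finset (Finset ℕ) → Prop) [DecidablePred q] :
    randomMatching n {M | q M.edges} = ENNReal.ofReal
      (((perfectMatchings (Finset.Icc 1 (2 * n))).filter q).card /
        (perfectMatchings (Finset.Icc 1 (2 * n))).card) := by
  have := Fintype.ofFinite (OrderedMatching n)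
  have huniv := card_filter_edges (n := n) fun _ => True
  simp only [Finset.filter_true, Finset.card_univ] at huniv
  rw [randomMatching, uniformOn_univ, huniv, ← card_filter_edges, ENNReal.ofReal_div_of_pos
    (Nat.cast_pos.2 (card_perfectMatchings_pos n)), ENNReal.ofReal_natCast,
    ENNReal.ofReal_natCast]
  congr 1
  rw [← Measure.count_apply_finset' MeasurableSpace.measurableSet_top]
  simp

theorem randomMatching_isAtypical_le (hn : 0 < n) (s : ℕ) :
    randomMatching n {M | IsAtypical n s M.edges} ≤
      ENNReal.ofReal ((2 * n + 1) * ((n + 1) * Real.exp (-(8 * s ^ 2 / n)))) := by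
  classical
  rw [randomMatching_setOf_edges]
  refine ENNReal.ofReal_le_ofReal ?_
  rw [div_le_iff₀ (Nat.cast_pos.2 (card_perfectMatchings_pos n))]
  refine (card_filter_isAtypical_le hn s).trans_eq ?_
  ring

/-- Here `8s²/n ≥ 3 log n`, so the exponential is at most `n⁻³` and beats the quadratic prefactor.
-/
theorem union_bound_le (hn : 0 < n) {s : ℕ} (hs : (n : ℝ) * Real.log n ≤ (s : ℝ) ^ 2) :
    (2 * (n : ℝ) + 1) * ((n + 1) * Real.exp (-(8 * s ^ 2 / n))) ≤ 6 / n := by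
  have hn' : (0 : ℝ) < n := Nat.cast_pos.2 hn
  have hn1 : (1 : ℝ) ≤ n := by exact_mod_cast hn
  have hlog : 0 ≤ Real.log n := Real.log_nonneg hn1
  have h1 : 3 * Real.log n ≤ 8 * s ^ 2 / n := by
    rw [le_div_iff₀ hn']
    nlinarith [mul_nonneg hn'.le hlog]
  have h2 : Real.exp (-(8 * s ^ 2 / n)) ≤ ((n : ℝ) ^ 3)⁻¹ := by
    calc Real.exp (-(8 * s ^ 2 / n)) ≤ Real.exp (-(3 * Real.log n)) :=
          Real.exp_le_exp.2 (neg_le_neg h1)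
      _ = ((n : ℝ) ^ 3)⁻¹ := by
          rw [Real.exp_neg, ← Real.exp_log (pow_pos hn' 3), Real.log_pow]
          norm_num
  calc (2 * (n : ℝ) + 1) * ((n + 1) * Real.exp (-(8 * s ^ 2 / n)))
      ≤ (3 * n) * ((2 * n) * ((n : ℝ) ^ 3)⁻¹) := by
        gcongr <;> linarith
    _ = 6 / n := by
        field_simp
        norm_num

theorem tendsto_randomMatching_sockNumber :
    Tendsto (fun n : ℕ => randomMatching n
      {M : OrderedMatching n |
        |(M.sockNumber : ℝ) - (n : ℝ) / 2| ≤ 8 * Real.sqrt ((n : ℝ) * Real.log (n : ℝ))})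
      atTop (𝓝 1) := by
  have hlim : Tendsto (fun n : ℕ => 1 - ENNReal.ofReal (6 / n)) atTop (𝓝 1) := by
    have h := ENNReal.tendsto_ofReal (tendsto_const_div_atTop_nhds_zero_nat (6 : ℝ))
    have h' := ENNReal.Tendsto.sub (tendsto_const_nhds (x := (1 : ENNReal)) (f := atTop)) h
      (Or.inl ENNReal.one_ne_top)
    simpa using h'
  refine tendsto_of_tendsto_of_tendsto_of_le_of_le' hlim tendsto_const_nhds ?_
    (Eventually.of_forall fun n => prob_le_one)
  -- From `n ≥ 3 > e` follows `x ≥ 1`, so rounding up costs at most a factor 2; hence the constant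
  -- `8 = 4 * 2`.
  filter_upwards [eventually_ge_atTop 3] with n hn
  have hn0 : 0 < n := by omega
  have hn3 : (3 : ℝ) ≤ n := by exact_mod_cast hn
  set x := Real.sqrt ((n : ℝ) * Real.log n) with hx
  have hlog : 1 ≤ Real.log n := by
    rw [Real.le_log_iff_exp_le (by linarith)]
    have := Real.exp_one_lt_d9
    linarith
  have hnl : 1 ≤ (n : ℝ) * Real.log n := by nlinarith
  have hx1 : 1 ≤ x := Real.one_le_sqrt.2 hnl
  set s := ⌈x⌉₊ with hs
  have hxs : x ≤ s := Nat.le_ceil x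
  have hsx : (s : ℝ) ≤ 2 * x := by
    have := Nat.ceil_lt_add_one (zero_le_one.trans hx1)
    linarith
  have hsq : (n : ℝ) * Real.log n ≤ (s : ℝ) ^ 2 := by
    rw [← Real.sq_sqrt (zero_le_one.trans hnl)]
    gcongr
  have hbad := (randomMatching_isAtypical_le hn0 s).trans
    (ENNReal.ofReal_le_ofReal (union_bound_le hn0 hsq))
  calc 1 - ENNReal.ofReal (6 / n)
      ≤ 1 - randomMatching n {M | IsAtypical n s M.edges} := tsub_le_tsub_left hbad 1
    _ = randomMatching n {M | IsAtypical n s M.edges}ᶜ :=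
        (prob_compl_eq_one_sub MeasurableSpace.measurableSet_top).symm
    _ ≤ _ := measure_mono fun M hM => (abs_sockNumber_sub_le hn0 M hM).trans (by linarith)

end OrderedMatching

theorem theorem2 :
    (∀ (n : ℕ) (M : OrderedMatching n),
      (∀ S : Finset (Finset ℕ), S ⊆ M.edges →
        (OrderedMatching.IsBipartite S ↔ OrderedMatching.IsAlignmentFree S)) ∧
      IsGreatest {m : ℕ | ∃ S : Finset (Finset ℕ), S ⊆ M.edges ∧
        OrderedMatching.IsBipartite S ∧ S.card = m} M.sockNumber) ∧
    ∃ C : ℝ, 0 < C ∧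
      Tendsto (fun n : ℕ => OrderedMatching.randomMatching n
        {M : OrderedMatching n |
          |(M.sockNumber : ℝ) - (n : ℝ) / 2| ≤ C * Real.sqrt ((n : ℝ) * Real.log (n : ℝ))})
        atTop (𝓝 1) := by
  refine ⟨fun n M => ⟨fun S hS => M.isBipartite_iff_isAlignmentFree hS,
    M.exists_isBipartite_card_eq, ?_⟩,
    8, by norm_num, OrderedMatching.tendsto_randomMatching_sockNumber⟩
  rintro m ⟨S, hS, hb, rfl⟩
  exact M.card_le_sockNumber hS hb
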